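/- **Setting.** Let $N\ge 1$ control areas $\mathcal N=\{1,\dots,N\}$ be connected by $m$ tie-lines, the edges of a connected simple undirected graph, each given an arbitrary direction. Let $\mathbf F\in\mathbb R^{N\times m}$ be the oriented incidence matrix ($\mathbf F_{ie}=1$, $-1$, $0$ if $e$ starts at $i$, ends at $i$, or is not incident to $i$), $\tilde{\mathbf F}$ the matrix $\mathbf F$ without its last row, $\mathbf B_l=\mathrm{diag}(B_e)$ with line parameters $B_e>0$, and $\mathbf T=[\mathbf I_{N-1},-\mathbf 1_{N-1}]$. For each area $i$ let constants $M_i,D_i,a_i,b_i,\beta_i>0$, $d_i\in\mathbb R$, $\underline w_i<0<\overline w_i$ and $\underline P_i,\overline P_i\in\mathbb R$ be given. Put $\mathcal P=\prod_i[\underline P_i,\overline P_i]$. For a state $z=(\alpha,w,P^r,\xi)\in\mathbb R^{N-1}\times\mathbb R^N\times\mathbb R^N\times\mathbb R^N$ define $$\tilde l_i(z)=D_iw_i+d_i+(\mathbf F\mathbf B_l\tilde{\mathbf F}^\top\alpha)_i+\beta_iM_i(\underline w_i-w_i),\qquad \tilde u_i(z)=D_iw_i+d_i+(\mathbf F\mathbf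 B_l\tilde{\mathbf F}^\top\alpha)_i-\beta_iM_i(w_i-\overline w_i),$$ $$P_{g,i}(z)=\min\Big\{\max\big\{P^r_i,\max\{\underline P_i,\tilde l_i(z)\}\big\},\ \min\{\overline P_i,\tilde u_i(z)\}\Big\},$$ and the vector field $F(z)$ with blocks $$\mathbf Tw,\qquad \big(M_i^{-1}(-D_iw_i+P_{g,i}(z)-d_i-(\mathbf F\mathbf B_l\tilde{\mathbf F}^\top\alpha)_i)\big)_i,\qquad (-a_iP^r_i-b_i-\xi_i-w_i)_i,\qquad (P^r_i-d_i)_i .$$ Let $\underline z,\overline z$ be vectors of lower and upper bounds, whose components may be infinite, such that $\mathcal Z=\{z:\underline z\le z\le\overline z\}\subseteq\mathbb R^{N-1}\times\mathbb R^N\times\mathcal P\times\mathbb R^N$. Consider the projected dynamical system $$\dot z=[F(z)]^{\overline z-z}_{z-\underline z},\tag{1}$$ where $[u]^{\overline z-z}_{z-\underline z}$ is defined componentwise: the $k$-th component is $0$ if ($z_k=\underline z_k$ and $u_k\le 0$) or ($z_k=\overline z_k$ and $u_k\ge 0$), and $u_k$ otherwise. A *Carathéodory solution* of (1) on $[0,T)$,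 $T>0$, with initial value $z_0\in\mathcal Z$ is an absolutely continuous $z:[0,T)\to\mathcal Z$ with $z(0)=z_0$ that satisfies (1) for almost every $t\in[0,T)$. **Theorem.** Let $z_0\in\mathcal Z$. Assume that along the system started at $z_0$ the safety-correction problem is feasible at all times, i.e. for every Carathéodory solution $z$ of (1) with $z(0)=z_0$, every $t$ in its interval of definition and every area $i$ there is $P\in[\underline P_i,\overline P_i]$ with $\tilde l_i(z(t))\le P\le\tilde u_i(z(t))$. Then there are $T>0$ and a Carathéodory solution $z:[0,T)\to\mathcal Z$ of (1) with $z(0)=z_0$, and it is unique: every Carathéodory solution $z'$ of (1) with $z'(0)=z_0$, on any interval $[0,T')$, coincides with $z$ on $[0,\min\{T,T'\})$. -/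

import Mathlib

noncomputable section

open Set MeasureTheory

/-- Data of a power system with `N = n + 1` control areas (the last one, `Fin.last n`, is the
angle reference) and `m` tie-lines, together with the controller parameters.
Tie-line `e` joins the areas `src e` and `tgt e`, with an arbitrarily chosen direction;
the tie-lines are the edges of a connected simple undirected graph on the areas. -/
structure MultiAreaSystem (n m : ℕ) where
  /-- first end of a tie-line -/
  src : Fin m → Fin (n + 1)
  /-- second end of a tie-line -/
  tgt : Fin m → Fin (n + 1)
  src_ne_tgt : ∀ e, src e ≠ tgt e
  edge_injective : Function.Injective fun e => s(src e, tgt e)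
  connected : (SimpleGraph.fromEdgeSet (Set.range fun e => s(src e, tgt e))).Connected
  /-- line sensitivities `B_{ij}` -/
  B : Fin m → ℝ
  B_pos : ∀ e, 0 < B e
  /-- inertias `M_i` -/
  M : Fin (n + 1) → ℝ
  M_pos : ∀ i, 0 < M i
  /-- dampings `D_i` -/
  D : Fin (n + 1) → ℝ
  D_pos : ∀ i, 0 < D i
  /-- net loads `d_i` -/
  d : Fin (n + 1) → ℝ
  /-- quadratic cost coefficients `a_{g,i}` -/
  a : Fin (n + 1) → ℝ
  a_pos : ∀ i, 0 < a i
  /-- linear cost coefficients `b_{g,i}` -/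
  b : Fin (n + 1) → ℝ
  b_pos : ∀ i, 0 < b i
  /-- barrier parameters `β_i` -/
  β : Fin (n + 1) → ℝ
  β_pos : ∀ i, 0 < β i
  /-- lower safe frequency bounds -/
  wlo : Fin (n + 1) → ℝ
  wlo_neg : ∀ i, wlo i < 0
  /-- upper safe frequency bounds -/
  whi : Fin (n + 1) → ℝ
  whi_pos : ∀ i, 0 < whi i
  /-- lower generation capacity limits -/
  Plo : Fin (n + 1) → ℝ
  /-- upper generation capacity limits -/
  Phi : Fin (n + 1) → ℝ

/-- Names of the coordinates of the state `z = (α, w_g, P_g^r, ξ)`. -/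
inductive Coord (n : ℕ) where
  | angle (i : Fin n)
  | freq (i : Fin (n + 1))
  | ref (i : Fin (n + 1))
  | mult (i : Fin (n + 1))
  deriving DecidableEq, Fintype

/-- The state space `ℝ^{N-1} × ℝ^N × ℝ^N × ℝ^N` with the Euclidean norm. -/
abbrev PState (n : ℕ) := EuclideanSpace ℝ (Coord n)

namespace PState

variable {n : ℕ}

/-- reduced angles `α_1, …, α_{N-1}` -/
def α (z : PState n) : Fin n → ℝ := fun i => z (Coord.angle i)

/-- frequencies `w_1, …, w_N` -/
def w (z : PState n) : Fin (n + 1) → ℝ := fun i => z (Coord.freq i)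

/-- generation reference signals `P_{g,1}^r, …, P_{g,N}^r` -/
def Pr (z : PState n) : Fin (n + 1) → ℝ := fun i => z (Coord.ref i)

/-- multipliers `ξ_1, …, ξ_N` -/
def ξ (z : PState n) : Fin (n + 1) → ℝ := fun i => z (Coord.mult i)

end PState

/-! Projected dynamical systems on a box -/

section Projected

variable {ι : Type*}

/-- The box `{x | lo ≤ x ≤ hi}`; a bound may be infinite. -/
def box (lo hi : ι → EReal) : Set (EuclideanSpace ℝ ι) :=
  {x | ∀ i, lo i ≤ (x i : EReal) ∧ (x i : EReal) ≤ hi i}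

open Classical in
/-- The scalar projection `[u]_{x - lo}^{hi - x}`: it is `0` if `x = lo` and `u ≤ 0`, or if
`x = hi` and `u ≥ 0`, and it is `u` otherwise. -/
def projScalar (lo hi : EReal) (x u : ℝ) : ℝ :=
  if ((x : EReal) = lo ∧ u ≤ 0) ∨ ((x : EReal) = hi ∧ 0 ≤ u) then 0 else u

/-- The componentwise projection `[u]_{x - lo}^{hi - x}`. -/
def projVec (lo hi : ι → EReal) (x u : EuclideanSpace ℝ ι) : EuclideanSpace ℝ ι :=
  WithLp.toLp 2 fun i => projScalar (lo i) (hi i) (x i) (u i)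

variable [Fintype ι]

/-- Absolute continuity on the half-open interval `[0, T)`. An absolutely continuous function
on `[0, T)` has a unique absolutely continuous extension to `[0, T]`, so this is coincidence on
`[0, T)` with an absolutely continuous function on `[0, T]` (the value of `x` at `T` plays no
role). -/
def AbsContOnIco (x : ℝ → EuclideanSpace ℝ ι) (T : ℝ) : Prop :=
  ∃ y : ℝ → EuclideanSpace ℝ ι, AbsolutelyContinuousOnInterval y 0 T ∧ EqOn x y (Ico 0 T)

/-- `x : [0, T) → box lo hi` is a Carathéodory solution of `x' = [G x]_{x - lo}^{hi - x}` with
initial condition `x 0 = x₀`. Only the values of `x` on `[0, T)` matter. -/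
structure IsCaratheodorySolution (lo hi : ι → EReal)
    (G : EuclideanSpace ℝ ι → EuclideanSpace ℝ ι) (x₀ : EuclideanSpace ℝ ι) (T : ℝ)
    (x : ℝ → EuclideanSpace ℝ ι) : Prop where
  T_pos : 0 < T
  mem_box : ∀ t ∈ Ico 0 T, x t ∈ box lo hi
  absCont : AbsContOnIco x T
  initial : x 0 = x₀
  ode : ∀ᵐ t ∂(volume.restrict (Ico 0 T)), HasDerivAt x (projVec lo hi (x t) (G (x t))) t

end Projected

namespace MultiAreaSystem

open Matrix

variable {n m : ℕ} (S : MultiAreaSystem n m)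

/-- The (oriented) incidence matrix `F`. -/
def inc : Matrix (Fin (n + 1)) (Fin m) ℝ :=
  fun i e => if S.src e = i then 1 else if S.tgt e = i then -1 else 0

/-- The reduced incidence matrix: `F` without its last row. -/
def redInc : Matrix (Fin n) (Fin m) ℝ := fun i e => S.inc i.castSucc e

/-- The matrix `T = [I_{N-1}, -1_{N-1}]`. -/
def refMatrix (n : ℕ) : Matrix (Fin n) (Fin (n + 1)) ℝ :=
  fun i j => if j = i.castSucc then 1 else if j = Fin.last n then -1 else 0

/-- The tie-line power flows out of the areas, `F B_l F̃ᵀ α`. -/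
def flow (α : Fin n → ℝ) : Fin (n + 1) → ℝ :=
  (S.inc * diagonal S.B * S.redIncᵀ) *ᵥ α

/-- The lower barrier bound `D w + d + F B_l F̃ᵀ α + Γ M (wlo - w)`. -/
def lTilde (z : PState n) (i : Fin (n + 1)) : ℝ :=
  S.D i * z.w i + S.d i + S.flow z.α i + S.β i * S.M i * (S.wlo i - z.w i)

/-- The upper barrier bound `D w + d + F B_l F̃ᵀ α - Γ M (w - whi)`. -/
def uTilde (z : PState n) (i : Fin (n + 1)) : ℝ :=
  S.D i * z.w i + S.d i + S.flow z.α i - S.β i * S.M i * (z.w i - S.whi i)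

/-- The feasible set of the safety-correction quadratic program
`min ½ (P - P_{g,i}^r)²` of area `i` at state `z`: capacity limits and barrier conditions. -/
def admissible (z : PState n) (i : Fin (n + 1)) : Set ℝ :=
  {P | (S.Plo i ≤ P ∧ P ≤ S.Phi i) ∧ S.lTilde z i ≤ P ∧ P ≤ S.uTilde z i}

/-- `l_b = max {Plo, lTilde}` -/
def lb (z : PState n) (i : Fin (n + 1)) : ℝ := max (S.Plo i) (S.lTilde z i)

/-- `u_b = min {Phi, uTilde}` -/
def ub (z : PState n) (i : Fin (n + 1)) : ℝ := min (S.Phi i) (S.uTilde z i)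

/-- The safety corrector `P_g(z) = min {max {P_g^r, l_b}, u_b}`. -/
def corrector (z : PState n) (i : Fin (n + 1)) : ℝ := min (max (z.Pr i) (S.lb z i)) (S.ub z i)

/-- The closed-loop vector field `F(z)` (before projection). -/
def field (z : PState n) : PState n :=
  WithLp.toLp 2 fun
    | Coord.angle i => (refMatrix n *ᵥ z.w) i
    | Coord.freq i =>
        (S.M i)⁻¹ * (-(S.D i * z.w i) + S.corrector z i - S.d i - S.flow z.α i)
    | Coord.ref i => -(S.a i * z.Pr i) - S.b i - z.ξ i - z.w i
    | Coord.mult i => z.Pr i - S.d i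

/-- The set `ℝ^{N-1} × ℝ^N × 𝒫 × ℝ^N`, where `𝒫` is the product of the capacity intervals. -/
def capacitySet : Set (PState n) := {z | ∀ i, z.Pr i ∈ Icc (S.Plo i) (S.Phi i)}

/-- Feasibility of the safety-correction problem of every area at all times along the
closed-loop system started at `z₀`. -/
def CorrectorFeasible (zlo zhi : Coord n → EReal) (z₀ : PState n) : Prop :=
  ∀ (T : ℝ) (z : ℝ → PState n), IsCaratheodorySolution zlo zhi S.field z₀ T z →
    ∀ t ∈ Ico 0 T, ∀ i, (S.admissible (z t) i).Nonempty

end MultiAreaSystem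

end

noncomputable section

open Set MeasureTheory Filter Topology NNReal

/-! The field is built from affine functions by finitely many `max` and `min`, so it is globally
Lipschitz (`isLipschitz_field`). The theorem then holds for any Lipschitz field projected onto a
box.

Existence: each coordinate of the initial point is interior, on one bound, or pinned between equal
bounds, and for a short time no other bound matters. The projection can therefore be replaced,
coordinate by coordinate, by an explicit map on paths: the identity, a Skorokhod reflection `X + sup
(c - X)⁺` or its mirror image, or a constant (`exists_isLocalReflection`). These maps are
2-Lipschitz in the sup norm, so composing them with the Picard integral gives a contraction on a
short interval, although the projected field is discontinuous. Its fixed point is a solution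
(`exists_isCaratheodorySolution`).

Uniqueness: the projection only removes outward velocity, so it never increases `⟨x - y, x' - y'⟩`.
Hence `‖x - y‖²` satisfies a Gronwall inequality (`IsCaratheodorySolution.eqOn`). -/

/-- The running maximum `max {f s | 0 ≤ s ≤ t}` of `f`. -/
def runningMax (f : ℝ → ℝ) (t : ℝ) : ℝ := sSup ((fun r => f (r * t)) '' Icc 0 1)

/-! ### Running maxima: continuity, monotonicity and stability -/

section RunningMax

variable {f g : ℝ → ℝ} {s t C : ℝ}

/-- Rescaling the parameter to `[0, 1]` makes this a supremum over a fixed compact set. -/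
theorem continuous_runningMax (hf : Continuous f) : Continuous (runningMax f) :=
  isCompact_Icc.continuous_sSup (f := fun t r => f (r * t)) (by fun_prop)

theorem le_runningMax (hf : Continuous f) (hs : 0 ≤ s) (hst : s ≤ t) : f s ≤ runningMax f t := by
  have hbdd : BddAbove ((fun r => f (r * t)) '' Icc 0 1) :=
    isCompact_Icc.bddAbove_image (by fun_prop)
  refine le_csSup hbdd ?_
  rcases (hs.trans hst).eq_or_lt with h0 | h0
  · exact ⟨0, by simp, by simp [show s = 0 by linarith]⟩
  · exact ⟨s / t, ⟨by positivity, (div_le_one h0).2 hst⟩, by simp [h0.ne']⟩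

theorem runningMax_le (ht : 0 ≤ t) (h : ∀ s, 0 ≤ s → s ≤ t → f s ≤ C) : runningMax f t ≤ C := by
  refine csSup_le (Nonempty.image _ (by simp)) ?_
  rintro _ ⟨r, hr, rfl⟩
  exact h _ (mul_nonneg hr.1 ht) (mul_le_of_le_one_left ht hr.2)

theorem runningMax_zero : runningMax f 0 = f 0 := by
  simp [runningMax]

theorem runningMax_mono (hf : Continuous f) (hs : 0 ≤ s) (hst : s ≤ t) :
    runningMax f s ≤ runningMax f t :=
  runningMax_le hs fun _ h0 h1 => le_runningMax hf h0 (h1.trans hst)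

theorem abs_runningMax_sub_le (hf : Continuous f) (hg : Continuous g) (ht : 0 ≤ t)
    (h : ∀ s ∈ Icc 0 t, |f s - g s| ≤ C) : |runningMax f t - runningMax g t| ≤ C := by
  rw [abs_sub_le_iff]
  constructor
  · suffices runningMax f t ≤ C + runningMax g t by linarith
    refine runningMax_le ht fun s h0 h1 => ?_
    linarith [(abs_sub_le_iff.1 (h s ⟨h0, h1⟩)).1, le_runningMax hg h0 h1]
  · suffices runningMax g t ≤ C + runningMax f t by linarith
    refine runningMax_le ht fun s h0 h1 => ?_
    linarith [(abs_sub_le_iff.1 (h s ⟨h0, h1⟩)).2, le_runningMax hf h0 h1]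

/-- Between `s` and `t` the maximum can grow only through values of `f` on `[s, t]`, which exceed `f
s` by at most `K * dist t s`. -/
theorem lipschitzOnWith_runningMax {T : ℝ} {K : ℝ≥0} (hf : Continuous f)
    (hK : LipschitzOnWith K f (Icc 0 T)) : LipschitzOnWith K (runningMax f) (Icc 0 T) := by
  refine LipschitzOnWith.of_le_add_mul _ fun t ht s hs => ?_
  refine runningMax_le ht.1 fun r h0 h1 => ?_
  rcases le_total r s with hrs | hrs
  · have := le_runningMax hf h0 hrs
    have : (0 : ℝ) ≤ K * dist t s := by positivity
    linarith
  · have h2 := hK.le_add_mul ⟨h0, h1.trans ht.2⟩ hs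
    have h3 : dist r s ≤ dist t s := by
      rw [Real.dist_eq, Real.dist_eq, abs_of_nonneg (by linarith), abs_of_nonneg (by linarith)]
      linarith
    have h4 := mul_le_mul_of_nonneg_left h3 K.2
    have h5 := le_runningMax hf hs.1 (le_refl s)
    linarith!

end RunningMax

/-- The regulator of the Skorokhod problem above the level `c` for the input `X`. -/
def regulator (c : ℝ) (X : ℝ → ℝ) : ℝ → ℝ := runningMax fun s => max 0 (c - X s)

/-! ### The one-sided Skorokhod problem in dimension one -/

section Regulator

variable {c t : ℝ} {X Y u : ℝ → ℝ}

theorem continuous_regulator (hX : Continuous X) : Continuous (regulator c X) :=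
  continuous_runningMax (by fun_prop)

theorem le_add_regulator (hX : Continuous X) (ht : 0 ≤ t) : c ≤ X t + regulator c X t := by
  have := le_runningMax (f := fun s => max 0 (c - X s)) (by fun_prop) ht (le_refl t)
  have := (le_max_right 0 (c - X t)).trans this
  rw [regulator]
  linarith

theorem regulator_mono (hX : Continuous X) : MonotoneOn (regulator c X) (Ici 0) :=
  fun _ hs _ _ hst => runningMax_mono (by fun_prop) hs hst

theorem regulator_zero (h0 : X 0 = c) : regulator c X 0 = 0 := by
  simp [regulator, runningMax_zero, h0]

theorem abs_add_regulator_sub_le {C : ℝ} (hX : Continuous X) (hY : Continuous Y) (ht : 0 ≤ t)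
    (h : ∀ s ∈ Icc 0 t, |X s - Y s| ≤ C) :
    |(X t + regulator c X t) - (Y t + regulator c Y t)| ≤ 2 * C := by
  have h1 : |regulator c X t - regulator c Y t| ≤ C := by
    refine abs_runningMax_sub_le (by fun_prop) (by fun_prop) ht fun s hs => ?_
    refine (abs_max_sub_max_le_max _ _ _ _).trans ?_
    have := h s hs
    rw [abs_sub_comm] at this
    simpa [(abs_nonneg (Y s - X s)).trans this] using this
  have h2 := h t ⟨ht, le_rfl⟩
  calc _ = |(X t - Y t) + (regulator c X t - regulator c Y t)| := by ring_nf
    _ ≤ _ := abs_add_le _ _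
    _ ≤ 2 * C := by linarith

theorem lipschitzOnWith_regulator {T : ℝ} {K : ℝ≥0} (hX : Continuous X)
    (hK : LipschitzOnWith K X (Icc 0 T)) : LipschitzOnWith K (regulator c X) (Icc 0 T) := by
  refine lipschitzOnWith_runningMax (by fun_prop) (LipschitzOnWith.of_le_add_mul _ ?_)
  intro t ht s hs
  have := hK.le_add_mul hs ht
  rw [dist_comm] at this
  have h0 : (0 : ℝ) ≤ K * dist t s := by positivity
  refine max_le ?_ ?_
  · linarith [le_max_left 0 (c - X s)]
  · linarith [le_max_right 0 (c - X s)]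

/-- Off the barrier, `c - X` is strictly below the current maximum and stays so for a short time,
hence sets no new maximum. -/
theorem eventually_regulator_eq (hX : Continuous X) (ht : 0 ≤ t)
    (h : c < X t + regulator c X t) : ∀ᶠ s in 𝓝[≥] t, regulator c X s = regulator c X t := by
  have h1 : ∀ᶠ s in 𝓝 t, c - X s < regulator c X t :=
    (show Continuous fun s => c - X s by fun_prop).continuousAt.eventually_lt continuousAt_const
      (by linarith)
  obtain ⟨ε, hε, hball⟩ := Metric.eventually_nhds_iff.1 h1
  have h2 : ∀ᶠ s in 𝓝[≥] t, s < t + ε :=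
    mem_nhdsWithin_of_mem_nhds (Iio_mem_nhds (by linarith))
  filter_upwards [h2, self_mem_nhdsWithin] with s hs hts
  have hts : t ≤ s := hts
  refine le_antisymm (runningMax_le (ht.trans hts) fun r h0 h1 => ?_)
    (regulator_mono hX ht (ht.trans hts) hts)
  rcases le_total r t with hrt | hrt
  · exact le_runningMax (f := fun s => max 0 (c - X s)) (by fun_prop) h0 hrt
  · have h3 : (0 : ℝ) ≤ regulator c X t :=
      (le_max_left _ _).trans
        (le_runningMax (f := fun s => max 0 (c - X s)) (by fun_prop) ht (le_refl t))
    refine max_le h3 (hball ?_).le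
    rw [Real.dist_eq, abs_of_nonneg (by linarith)]
    linarith

/-- At interior points of differentiability the reflected path moves with the velocity of the
input, except on the barrier, where it stands still and the input pushes outwards. -/
theorem hasDerivAt_add_regulator {v : ℝ} (hX : Continuous X) (ht : 0 < t)
    (hv : HasDerivAt X v t) (hd : DifferentiableAt ℝ (regulator c X) t) :
    (c < X t + regulator c X t ∧ HasDerivAt (fun s => X s + regulator c X s) v t) ∨
    (X t + regulator c X t = c ∧ v ≤ 0 ∧ HasDerivAt (fun s => X s + regulator c X s) 0 t) := by
  have hd' := hd.hasDerivAt
  set r := deriv (regulator c X) t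
  have hsum := hv.add hd'
  rcases (le_add_regulator hX ht.le).lt_or_eq with h | h
  · left
    -- Differentiability is assumed, so constancy to the right of `t` determines the derivative.
    have hr : r = 0 := by
      have h1 : HasDerivWithinAt (regulator c X) 0 (Ici t) t :=
        (hasDerivWithinAt_const t (Ici t) (regulator c X t)).congr_of_eventuallyEq
          (eventually_regulator_eq hX ht.le h) rfl
      exact (uniqueDiffWithinAt_Ici t).eq_deriv _ hd'.hasDerivWithinAt h1
    rw [hr, add_zero] at hsum
    exact ⟨h, hsum⟩
  · right
    -- The reflected path never goes below `c`, so touching it is a local minimum: `v + r = 0`.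
    -- Monotonicity gives `r ≥ 0`, hence `v ≤ 0`.
    have hmin : IsLocalMin (X + regulator c X) t := by
      filter_upwards [Ioi_mem_nhds ht] with s hs
      simpa [← h] using le_add_regulator (c := c) hX (le_of_lt hs)
    have h0 := hmin.hasDerivAt_eq_zero hsum
    have hr : 0 ≤ r := by
      have := (regulator_mono (c := c) hX).derivWithin_nonneg (x := t)
      rwa [derivWithin_of_mem_nhds (Ici_mem_nhds ht)] at this
    rw [h0] at hsum
    exact ⟨h.symm, by linarith, hsum⟩

end Regulator

/-! ### Local reflections for each position of the initial value -/

section Reflection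

variable {lo hi : EReal} {c : ℝ}

theorem projScalar_neg (lo hi : EReal) (x u : ℝ) :
    projScalar (-hi) (-lo) (-x) (-u) = -projScalar lo hi x u := by
  simp only [projScalar, EReal.coe_neg, neg_inj, neg_nonpos, Left.nonneg_neg_iff]
  simp only [or_comm (a := (x : EReal) = hi ∧ 0 ≤ u)]
  split_ifs <;> simp

/-- `Γ` maps an input path `X` starting at `c` to a path which, for a short time, stays in
`[lo, hi]` and follows the projected velocity of `X`. -/
structure IsLocalReflection (lo hi : EReal) (c : ℝ) (Γ : (ℝ → ℝ) → ℝ → ℝ) : Prop where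
  continuous : ∀ X, Continuous X → Continuous (Γ X)
  abs_sub_le : ∀ X Y, Continuous X → Continuous Y → ∀ t, 0 ≤ t → ∀ C,
    (∀ s ∈ Icc 0 t, |X s - Y s| ≤ C) → |Γ X t - Γ Y t| ≤ 2 * C
  initial : ∀ X, X 0 = c → Γ X 0 = c
  solution : ∀ X u, Continuous u → (∀ t, HasDerivAt X (u t) t) → X 0 = c →
    ∀ᶠ T in 𝓝[>] (0 : ℝ), (∀ t ∈ Icc 0 T, lo ≤ (Γ X t : EReal) ∧ (Γ X t : EReal) ≤ hi) ∧
      (∃ K, LipschitzOnWith K (Γ X) (Icc 0 T)) ∧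
      ∀ᵐ t, t ∈ Ioo 0 T → HasDerivAt (Γ X) (projScalar lo hi (Γ X t) (u t)) t

theorem exists_lipschitzOnWith_Icc {X u : ℝ → ℝ} (hu : Continuous u)
    (hX : ∀ t, HasDerivAt X (u t) t) (T : ℝ) : ∃ K, LipschitzOnWith K X (Icc 0 T) := by
  have h : ContDiff ℝ 1 X := by
    rw [contDiff_one_iff_deriv]
    exact ⟨fun t => (hX t).differentiableAt, by rwa [funext fun t => (hX t).deriv]⟩
  exact h.contDiffOn.exists_lipschitzOnWith (by decide) (convex_Icc _ _) isCompact_Icc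

theorem eventually_Icc_of_eventually_nhds {p : ℝ → Prop} (h : ∀ᶠ t in 𝓝 (0 : ℝ), p t) :
    ∀ᶠ T in 𝓝[>] (0 : ℝ), ∀ t ∈ Icc 0 T, p t := by
  obtain ⟨ε, hε, hball⟩ := Metric.eventually_nhds_iff.1 h
  filter_upwards [Ioo_mem_nhdsGT hε] with T hT t ht
  refine hball ?_
  rw [Real.dist_eq, sub_zero, abs_of_nonneg ht.1]
  exact ht.2.trans_lt hT.2

theorem isLocalReflection_id (h₁ : lo < c) (h₂ : c < hi) :
    IsLocalReflection lo hi c fun X => X where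
  continuous _ h := h
  abs_sub_le X Y _ _ t ht C h := by
    have := h t ⟨ht, le_rfl⟩
    linarith [(abs_nonneg _).trans this]
  initial _ h := h
  solution X u hu hX h0 := by
    have hc : Continuous fun t => (X t : EReal) :=
      continuous_coe_real_ereal.comp
        (continuous_iff_continuousAt.2 fun t => (hX t).continuousAt)
    have e1 := (hc.tendsto 0).eventually_const_lt (u := lo) (by simpa [h0] using h₁)
    have e2 := (hc.tendsto 0).eventually_lt_const (u := hi) (by simpa [h0] using h₂)
    filter_upwards [eventually_Icc_of_eventually_nhds (e1.and e2)] with T hT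
    refine ⟨fun t ht => ⟨(hT t ht).1.le, (hT t ht).2.le⟩, exists_lipschitzOnWith_Icc hu hX T, ?_⟩
    refine Eventually.of_forall fun t ht => ?_
    obtain ⟨h3, h4⟩ := hT t ⟨ht.1.le, ht.2.le⟩
    simpa [projScalar, h3.ne', h4.ne] using hX t

theorem isLocalReflection_const (h₁ : lo = c) (h₂ : hi = c) :
    IsLocalReflection lo hi c fun _ _ => c where
  continuous _ _ := continuous_const
  abs_sub_le X Y _ _ t ht C h := by
    have := (abs_nonneg _).trans (h t ⟨ht, le_rfl⟩)
    simpa using this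
  initial _ _ := rfl
  solution X u hu hX h0 := by
    refine Eventually.of_forall fun T => ⟨fun t _ => by simp [h₁, h₂], ⟨0, ?_⟩, ?_⟩
    · exact LipschitzWith.const' c |>.lipschitzOnWith
    · refine Eventually.of_forall fun t _ => ?_
      have : projScalar lo hi c (u t) = 0 := by
        simp [projScalar, h₁, h₂, le_total]
      rw [this]
      exact hasDerivAt_const t c

/-- Continuity keeps the path away from `hi` for a short time. The regulator is Lipschitz there,
hence differentiable almost everywhere, and the dichotomy of `hasDerivAt_add_regulator` matches the
two branches of `projScalar`. -/
theorem isLocalReflection_lower (h₁ : lo = c) (h₂ : c < hi) :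
    IsLocalReflection lo hi c fun X t => X t + regulator c X t where
  continuous X h := h.add (continuous_regulator h)
  abs_sub_le X Y hX hY t ht C h := abs_add_regulator_sub_le hX hY ht h
  initial X h := by simp [regulator_zero h, h]
  solution X u hu hX h0 := by
    have hXc : Continuous X := continuous_iff_continuousAt.2 fun t => (hX t).continuousAt
    have hc : Continuous fun t => ((X t + regulator c X t : ℝ) : EReal) :=
      continuous_coe_real_ereal.comp (hXc.add (continuous_regulator hXc))
    have e2 := (hc.tendsto 0).eventually_lt_const (u := hi)
      (by simpa [h0, regulator_zero h0] using h₂)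
    filter_upwards [eventually_Icc_of_eventually_nhds e2] with T hT
    obtain ⟨K, hK⟩ := exists_lipschitzOnWith_Icc hu hX T
    refine ⟨fun t ht => ⟨?_, (hT t ht).le⟩,
      ⟨K + K, hK.add (lipschitzOnWith_regulator hXc hK)⟩, ?_⟩
    · rw [h₁]
      exact_mod_cast le_add_regulator hXc ht.1
    · have hdiff := (lipschitzOnWith_regulator (c := c) hXc hK).ae_differentiableWithinAt_of_mem_of_real
        (μ := volume)
      filter_upwards [hdiff] with t hd ht
      have hd' : DifferentiableAt ℝ (regulator c X) t :=
        (hd ⟨ht.1.le, ht.2.le⟩).differentiableAt (Icc_mem_nhds ht.1 ht.2)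
      have hne := (hT t ⟨ht.1.le, ht.2.le⟩).ne
      rcases hasDerivAt_add_regulator hXc ht.1 (hX t) hd' with ⟨h3, h4⟩ | ⟨h3, h4, h5⟩
      · have : projScalar lo hi (X t + regulator c X t) (u t) = u t := by
          rw [projScalar, if_neg]
          rintro (⟨h, -⟩ | ⟨h, -⟩)
          · rw [h₁, EReal.coe_eq_coe_iff] at h
            exact h3.ne' h
          · exact hne h
        rwa [this]
      · have : projScalar lo hi (X t + regulator c X t) (u t) = 0 := by
          rw [projScalar, if_pos]
          exact Or.inl ⟨by rw [h3, h₁], h4⟩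
        rwa [this]

/-- The sign change swaps the two bounds, so the upper barrier reduces to the lower one. -/
theorem IsLocalReflection.neg {Γ : (ℝ → ℝ) → ℝ → ℝ} (h : IsLocalReflection (-hi) (-lo) (-c) Γ) :
    IsLocalReflection lo hi c fun X => -Γ (-X) where
  continuous X hX := (h.continuous _ hX.neg).neg
  abs_sub_le X Y hX hY t ht C hC := by
    have := h.abs_sub_le _ _ hX.neg hY.neg t ht C fun s hs => by
      rw [Pi.neg_apply, Pi.neg_apply, ← neg_sub', abs_neg]; exact hC s hs
    rwa [Pi.neg_apply, Pi.neg_apply, ← neg_sub', abs_neg]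
  initial X hX := by
    rw [Pi.neg_apply, h.initial (-X) (by simp [hX]), neg_neg]
  solution X u hu hX h0 := by
    filter_upwards [h.solution (-X) (-u) hu.neg (fun t => (hX t).neg) (by simp [h0])] with T hT
    obtain ⟨h1, ⟨K, hK⟩, h3⟩ := hT
    refine ⟨fun t ht => ?_, ⟨K, hK.neg⟩, ?_⟩
    · obtain ⟨h4, h5⟩ := h1 t ht
      rw [Pi.neg_apply, EReal.coe_neg]
      exact ⟨EReal.le_neg_of_le_neg h5, EReal.neg_le_of_neg_le h4⟩
    · filter_upwards [h3] with t ht htT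
      have h6 := (ht htT).neg
      have h7 := projScalar_neg lo hi (-Γ (-X) t) (u t)
      rw [neg_neg] at h7
      rwa [Pi.neg_apply, h7, neg_neg] at h6

theorem exists_isLocalReflection (h₁ : lo ≤ c) (h₂ : c ≤ hi) :
    ∃ Γ, IsLocalReflection lo hi c Γ := by
  rcases h₁.lt_or_eq with h₁ | h₁ <;> rcases h₂.lt_or_eq with h₂ | h₂
  · exact ⟨_, isLocalReflection_id h₁ h₂⟩
  · refine ⟨_, (isLocalReflection_lower (c := -c) ?_ ?_).neg⟩
    · simp [← h₂]
    · simpa [EReal.neg_lt_neg_iff] using h₁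
  · exact ⟨_, isLocalReflection_lower h₁ h₂⟩
  · exact ⟨_, isLocalReflection_const h₁ h₂.symm⟩

end Reflection

/-! ### Local existence by Picard iteration through the reflections -/

section Existence

variable {ι : Type*}

/-- The Picard primitive `c + ∫₀ᵗ H(x(s)) ds` of a path `x` on `[0, T]`, extended constantly. -/
def picardPrimitive {T : ℝ} (hT : 0 ≤ T) (H : (ι → ℝ) → ℝ) (c : ℝ) (x : C(Icc 0 T, ι → ℝ))
    (t : ℝ) : ℝ :=
  c + ∫ s in (0 : ℝ)..t, H (IccExtend hT x s)

variable {T c : ℝ} {hT : 0 ≤ T} {H : (ι → ℝ) → ℝ}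

theorem picardPrimitive_zero (x : C(Icc 0 T, ι → ℝ)) : picardPrimitive hT H c x 0 = c := by
  simp [picardPrimitive]

/-- The constant extension makes the integrand continuous on all of `ℝ`, which gives the global
differentiability required by `IsLocalReflection.solution`. -/
theorem hasDerivAt_picardPrimitive (hH : Continuous H) (x : C(Icc 0 T, ι → ℝ)) (t : ℝ) :
    HasDerivAt (picardPrimitive hT H c x) (H (IccExtend hT x t)) t := by
  have hc : Continuous fun s => H (IccExtend hT x s) := hH.comp x.continuous.Icc_extend'
  exact (hc.integral_hasStrictDerivAt 0 t).hasDerivAt.const_add c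

theorem continuous_picardPrimitive (hH : Continuous H) (x : C(Icc 0 T, ι → ℝ)) :
    Continuous (picardPrimitive hT H c x) :=
  continuous_iff_continuousAt.2 fun t => (hasDerivAt_picardPrimitive hH x t).continuousAt

variable [Fintype ι] {K : ℝ≥0}

theorem abs_picardPrimitive_sub_le (hH : LipschitzWith K H) (x y : C(Icc 0 T, ι → ℝ)) {t : ℝ}
    (ht : t ∈ Icc 0 T) :
    |picardPrimitive hT H c x t - picardPrimitive hT H c y t| ≤ K * dist x y * T := by
  have hc (x : C(Icc 0 T, ι → ℝ)) :
      IntervalIntegrable (fun s => H (IccExtend hT x s)) volume 0 t :=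
    (hH.continuous.comp x.continuous.Icc_extend').intervalIntegrable _ _
  rw [picardPrimitive, picardPrimitive, add_sub_add_left_eq_sub,
    ← intervalIntegral.integral_sub (hc x) (hc y), ← Real.norm_eq_abs]
  refine (intervalIntegral.norm_integral_le_of_norm_le_const (C := K * dist x y) ?_).trans ?_
  · intro s _
    rw [← dist_eq_norm]
    exact (hH.dist_le_mul _ _).trans
      (mul_le_mul_of_nonneg_left (ContinuousMap.dist_apply_le_dist _) K.2)
  · rw [sub_zero, abs_of_nonneg ht.1]
    exact mul_le_mul_of_nonneg_left ht.2 (by positivity)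

/-- A projected dynamical system on a box with a Lipschitz vector field has a local
Carathéodory solution from every point of the box. -/
theorem exists_isCaratheodorySolution {lo hi : ι → EReal}
    {G : EuclideanSpace ℝ ι → EuclideanSpace ℝ ι} (hG : LipschitzWith K G)
    {x₀ : EuclideanSpace ℝ ι} (hx₀ : x₀ ∈ box lo hi) :
    ∃ (T : ℝ) (x : ℝ → EuclideanSpace ℝ ι), IsCaratheodorySolution lo hi G x₀ T x := by
  choose Γ hΓ using fun i => exists_isLocalReflection (hx₀ i).1 (hx₀ i).2
  let H (i : ι) (v : ι → ℝ) : ℝ := G (WithLp.toLp 2 v) i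
  obtain ⟨L, hH⟩ : ∃ L, ∀ i, LipschitzWith L (H i) :=
    ⟨_, fun i => ((LipschitzWith.eval i).comp (PiLp.lipschitzWith_ofLp 2 fun _ : ι => ℝ)).comp
      (hG.comp (PiLp.lipschitzWith_toLp 2 fun _ : ι => ℝ))⟩
  -- The Picard primitive contributes a factor `L * T` and the reflection a factor `2`. The `+ 1`
  -- covers `L = 0`.
  let T : ℝ := 1 / (4 * (L + 1))
  have hT : 0 < T := by positivity
  have hLT : 2 * (L * T) ≤ 1 / 2 := by
    have : (0 : ℝ) < L + 1 := by positivity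
    simp only [T]
    field_simp
    linarith
  let X (i : ι) (x : C(Icc 0 T, ι → ℝ)) : ℝ → ℝ := picardPrimitive hT.le (H i) (x₀ i) x
  have hX0 (i x) : X i x 0 = x₀ i := picardPrimitive_zero x
  have hXc (i x) : Continuous (X i x) := continuous_picardPrimitive (hH i).continuous x
  let Φ (x : C(Icc 0 T, ι → ℝ)) : C(Icc 0 T, ι → ℝ) :=
    ⟨fun t i => Γ i (X i x) t,
      continuous_pi fun i => ((hΓ i).continuous _ (hXc i x)).comp continuous_subtype_val⟩
  have hΦ : ContractingWith (1 / 2) Φ := by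
    refine ⟨by norm_num, LipschitzWith.of_dist_le_mul fun x y => ?_⟩
    have h0 : (0 : ℝ) ≤ ((1 / 2 : ℝ≥0) : ℝ) * dist x y := by positivity
    refine (ContinuousMap.dist_le h0).2 fun t => (dist_pi_le_iff h0).2 fun i => ?_
    rw [Real.dist_eq]
    refine ((hΓ i).abs_sub_le _ _ (hXc i x) (hXc i y) t t.2.1 _ fun s hs =>
      abs_picardPrimitive_sub_le (hH i) x y ⟨hs.1, hs.2.trans t.2.2⟩).trans ?_
    push_cast
    nlinarith [dist_nonneg (x := x) (y := y)]
  obtain ⟨x, hx⟩ : ∃ x, Φ x = x := ⟨_, hΦ.fixedPoint_isFixedPt⟩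
  have hev := fun i => (hΓ i).solution (X i x) _
    ((hH i).continuous.comp x.continuous.Icc_extend')
    (hasDerivAt_picardPrimitive (hH i).continuous x) (hX0 i x)
  -- The fixed point lives on `[0, T]`, but it need only follow the projected dynamics up to a `τ`
  -- before which no coordinate leaves the validity range of its reflection.
  obtain ⟨τ, hτ, hτ0, hτT⟩ := ((eventually_all.2 hev).and (Ioo_mem_nhdsGT hT)).exists
  let z (t : ℝ) : EuclideanSpace ℝ ι := WithLp.toLp 2 fun i => Γ i (X i x) t
  have hz : ∀ t ∈ Icc 0 τ, WithLp.toLp 2 (IccExtend hT.le x t) = z t := fun t ht => by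
    rw [IccExtend_of_mem _ _ ⟨ht.1, ht.2.trans hτT.le⟩]
    conv_lhs => rw [← hx]
    rfl
  refine ⟨τ, z, hτ0, fun t ht i => (hτ i).1 t ⟨ht.1, ht.2.le⟩, ⟨z, ?_, fun _ _ => rfl⟩, ?_, ?_⟩
  · choose k hk using fun i => (hτ i).2.1
    refine LipschitzOnWith.absolutelyContinuousOnInterval
      (K := Fintype.card ι ^ (1 / (2 : ENNReal)).toReal * Finset.univ.sup k) ?_
    rw [uIcc_of_le hτ0.le]
    refine (PiLp.lipschitzWith_toLp 2 fun _ : ι => ℝ).comp_lipschitzOnWith ?_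
    refine LipschitzOnWith.of_dist_le_mul fun s hs t ht => ?_
    refine (dist_pi_le_iff (by positivity)).2 fun i => ((hk i).dist_le_mul s hs t ht).trans ?_
    gcongr
    exact Finset.le_sup (Finset.mem_univ i)
  · ext i
    exact (hΓ i).initial _ (hX0 i x)
  -- The endpoint `0` is a null set and can be dropped, since two-sided derivatives are available
  -- only inside.
  · rw [← Measure.restrict_congr_set Ioo_ae_eq_Ico, ae_restrict_iff' measurableSet_Ioo]
    filter_upwards [ae_all_iff.2 fun i => (hτ i).2.2] with t ht htτ
    refine ((PiLp.continuousLinearEquiv 2 ℝ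
      fun _ : ι => ℝ).symm.toContinuousLinearMap.hasFDerivAt.comp_hasDerivAt t
      (hasDerivAt_pi.2 fun i => ?_) : _)
    have h := ht i htτ
    simp only [Function.comp_apply, H, hz t ⟨htτ.1.le, htτ.2.le⟩] at h
    exact h

end Existence

/-! ### Uniqueness by monotonicity of the projection and Gronwall -/

section Uniqueness

theorem AbsolutelyContinuousOnInterval.norm {E : Type*} [NormedAddCommGroup E] {f : ℝ → E}
    {a b : ℝ} (hf : AbsolutelyContinuousOnInterval f a b) :
    AbsolutelyContinuousOnInterval (fun t => ‖f t‖) a b := by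
  rw [absolutelyContinuousOnInterval_iff] at hf ⊢
  intro ε hε
  obtain ⟨δ, hδ, h⟩ := hf ε hε
  refine ⟨δ, hδ, fun I hI hlen => (Finset.sum_le_sum fun i _ => ?_).trans_lt (h I hI hlen)⟩
  rw [Real.dist_eq, dist_eq_norm]
  exact abs_norm_sub_norm_le _ _

/-- Gronwall's inequality for absolutely continuous functions. -/
theorem AbsolutelyContinuousOnInterval.nonpos_of_deriv_le {V : ℝ → ℝ} {b C : ℝ} (hb : 0 ≤ b)
    (hV : AbsolutelyContinuousOnInterval V 0 b) (h0 : V 0 = 0)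
    (h : ∀ᵐ t, t ∈ Ioo 0 b → ∃ v, HasDerivAt V v t ∧ v ≤ C * V t) : V b ≤ 0 := by
  -- The integrating factor turns the hypothesis into `(exp (-C t) V)' ≤ 0` almost everywhere;
  -- absolute continuity allows this to be integrated.
  have hexp : AbsolutelyContinuousOnInterval (fun t => Real.exp (-(C * t))) 0 b :=
    ContDiffOn.absolutelyContinuousOnInterval (by fun_prop)
  have hW := (hexp.mul hV).integral_deriv_eq_sub
  have hint : ∫ t in (0 : ℝ)..b, deriv ((fun t => Real.exp (-(C * t))) * V) t ≤ 0 := by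
    rw [intervalIntegral.integral_of_le hb, Measure.restrict_congr_set Ioo_ae_eq_Ioc.symm]
    refine integral_nonpos_of_ae ?_
    rw [EventuallyLE, ae_restrict_iff' measurableSet_Ioo]
    filter_upwards [h] with t ht htb
    obtain ⟨v, hv, hle⟩ := ht htb
    have he : HasDerivAt (fun t => Real.exp (-(C * t))) (Real.exp (-(C * t)) * (-C)) t := by
      simpa using ((hasDerivAt_id t).const_mul C).neg.exp
    rw [(he.mul hv).deriv, Pi.zero_apply]
    have := mul_nonneg (Real.exp_pos (-(C * t))).le (sub_nonneg.2 hle)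
    linarith
  rw [hW] at hint
  simp only [Pi.mul_apply, h0, mul_zero, sub_zero] at hint
  exact nonpos_of_mul_nonpos_right hint (Real.exp_pos _)

/-- When `u` is set to `0`, it points outwards at a bound while `y` lies on the inner side, so `(x -
y) * u ≥ 0`. -/
theorem mul_projScalar_le {lo hi : EReal} {x y u : ℝ} (h₁ : lo ≤ y) (h₂ : (y : EReal) ≤ hi) :
    (x - y) * projScalar lo hi x u ≤ (x - y) * u := by
  rw [projScalar]
  split_ifs with h
  · rcases h with ⟨rfl, hu⟩ | ⟨rfl, hu⟩
    · have := EReal.coe_le_coe_iff.1 h₁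
      nlinarith
    · have := EReal.coe_le_coe_iff.1 h₂
      nlinarith
  · exact le_rfl

variable {ι : Type*} [Fintype ι] {lo hi : ι → EReal}

/-- The projected velocity is monotone up to the velocity itself. -/
theorem inner_projVec_sub_le {x y : EuclideanSpace ℝ ι} (hx : x ∈ box lo hi)
    (hy : y ∈ box lo hi) (u v : EuclideanSpace ℝ ι) :
    inner ℝ (x - y) (projVec lo hi x u - projVec lo hi y v) ≤ inner ℝ (x - y) (u - v) := by
  simp only [PiLp.inner_apply, RCLike.inner_apply, conj_trivial, PiLp.sub_apply, projVec]
  refine Finset.sum_le_sum fun i _ => ?_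
  have h1 := mul_projScalar_le (x := x i) (u := u i) (hy i).1 (hy i).2
  have h2 := mul_projScalar_le (x := y i) (u := v i) (hx i).1 (hx i).2
  linarith

theorem IsCaratheodorySolution.eqOn {G : EuclideanSpace ℝ ι → EuclideanSpace ℝ ι} {K : ℝ≥0}
    (hG : LipschitzWith K G) {x₀ : EuclideanSpace ℝ ι} {T T' : ℝ}
    {x y : ℝ → EuclideanSpace ℝ ι} (hx : IsCaratheodorySolution lo hi G x₀ T x)
    (hy : IsCaratheodorySolution lo hi G x₀ T' y) : EqOn x y (Ico 0 (min T T')) := by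
  intro b hb
  have hbT : b < T := hb.2.trans_le (min_le_left _ _)
  have hbT' : b < T' := hb.2.trans_le (min_le_right _ _)
  obtain ⟨x', hx', hxx'⟩ := hx.absCont
  obtain ⟨y', hy', hyy'⟩ := hy.absCont
  have hsub {S : ℝ} (hS : b < S) : uIcc 0 b ⊆ uIcc 0 S := by
    rw [uIcc_of_le hb.1, uIcc_of_le (hb.1.trans hS.le)]
    exact Icc_subset_Icc_right hS.le
  have hN := ((hx'.mono (hsub hbT)).sub (hy'.mono (hsub hbT'))).norm
  have hode {S : ℝ} {z : ℝ → EuclideanSpace ℝ ι} (hS : b < S)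
      (hz : IsCaratheodorySolution lo hi G x₀ S z) :
      ∀ᵐ t, t ∈ Ioo 0 b → HasDerivAt z (projVec lo hi (z t) (G (z t))) t := by
    filter_upwards [(ae_restrict_iff' measurableSet_Ico).1 hz.ode] with t ht htb
    exact ht ⟨htb.1.le, htb.2.trans hS⟩
  -- Here `V = ‖x' - y'‖²`, with the absolutely continuous representatives. Its derivative is twice
  -- the inner product of difference and velocity difference, at most `2 * K * V`.
  have key := (hN.mul hN).nonpos_of_deriv_le (C := 2 * K) hb.1 ?_ ?_
  · rw [Pi.mul_apply] at key
    rw [← sub_eq_zero, ← norm_eq_zero, hxx' ⟨hb.1, hbT⟩, hyy' ⟨hb.1, hbT'⟩]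
    exact mul_self_eq_zero.1 (le_antisymm key (mul_self_nonneg _))
  · simp [← hxx' ⟨le_rfl, hx.T_pos⟩, ← hyy' ⟨le_rfl, hy.T_pos⟩, hx.initial, hy.initial]
  · filter_upwards [hode hbT hx, hode hbT' hy] with t h1 h2 ht
    have hd := ((h1 ht).sub (h2 ht)).norm_sq
    have htx : t ∈ Ico 0 T := ⟨ht.1.le, ht.2.trans hbT⟩
    have hty : t ∈ Ico 0 T' := ⟨ht.1.le, ht.2.trans hbT'⟩
    refine ⟨_, hd.congr_of_eventuallyEq ?_, ?_⟩
    · filter_upwards [Ioo_mem_nhds ht.1 ht.2] with s hs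
      simp [pow_two, ← hxx' ⟨hs.1.le, hs.2.trans hbT⟩, ← hyy' ⟨hs.1.le, hs.2.trans hbT'⟩]
    · have h3 := inner_projVec_sub_le (hx.mem_box t htx) (hy.mem_box t hty) (G (x t)) (G (y t))
      have h4 := real_inner_le_norm (x t - y t) (G (x t) - G (y t))
      have h5 := mul_le_mul_of_nonneg_left (hG.norm_sub_le (x t) (y t)) (norm_nonneg (x t - y t))
      simp only [Pi.mul_apply, Pi.sub_apply, ← hxx' htx, ← hyy' hty]
      linarith

end Uniqueness

/-! Lipschitz continuity of the closed-loop field -/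

section Lipschitz

variable {E : Type*} [NormedAddCommGroup E]

/-- Lipschitz with some constant. -/
def IsLipschitz {F : Type*} [NormedAddCommGroup F] (f : E → F) : Prop := ∃ K, LipschitzWith K f

namespace IsLipschitz

variable {f g : E → ℝ}

theorem const (c : ℝ) : IsLipschitz fun _ : E => c := ⟨0, LipschitzWith.const c⟩

theorem add (hf : IsLipschitz f) (hg : IsLipschitz g) : IsLipschitz fun x => f x + g x := by
  obtain ⟨⟨_, hf⟩, ⟨_, hg⟩⟩ := hf, hg
  exact ⟨_, hf.add hg⟩

theorem neg (hf : IsLipschitz f) : IsLipschitz fun x => -f x := by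
  obtain ⟨_, hf⟩ := hf
  exact ⟨_, hf.neg⟩

theorem sub (hf : IsLipschitz f) (hg : IsLipschitz g) : IsLipschitz fun x => f x - g x := by
  obtain ⟨⟨_, hf⟩, ⟨_, hg⟩⟩ := hf, hg
  exact ⟨_, hf.sub hg⟩

theorem const_mul (c : ℝ) (hf : IsLipschitz f) : IsLipschitz fun x => c * f x := by
  obtain ⟨_, hf⟩ := hf
  exact ⟨_, (lipschitzWith_smul c).comp hf⟩

theorem max (hf : IsLipschitz f) (hg : IsLipschitz g) : IsLipschitz fun x => max (f x) (g x) := by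
  obtain ⟨⟨_, hf⟩, ⟨_, hg⟩⟩ := hf, hg
  exact ⟨_, hf.max hg⟩

theorem min (hf : IsLipschitz f) (hg : IsLipschitz g) : IsLipschitz fun x => min (f x) (g x) := by
  obtain ⟨⟨_, hf⟩, ⟨_, hg⟩⟩ := hf, hg
  exact ⟨_, hf.min hg⟩

theorem sum {κ : Type*} (s : Finset κ) {f : κ → E → ℝ} (hf : ∀ k, IsLipschitz (f k)) :
    IsLipschitz fun x => ∑ k ∈ s, f k x := by
  classical
  induction s using Finset.induction_on with
  | empty => simpa using const 0
  | insert k s hk ih => simpa [Finset.sum_insert hk] using (hf k).add ih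

theorem mulVec {κ κ' : Type*} [Fintype κ'] (A : Matrix κ κ' ℝ) {v : E → κ' → ℝ}
    (hv : ∀ k, IsLipschitz fun x => v x k) (i : κ) : IsLipschitz fun x => A.mulVec (v x) i :=
  sum _ fun k => (hv k).const_mul (A i k)

theorem coord {ι : Type*} [Fintype ι] (i : ι) : IsLipschitz fun x : EuclideanSpace ℝ ι => x i :=
  ⟨_, (LipschitzWith.eval i).comp (PiLp.lipschitzWith_ofLp 2 fun _ : ι => ℝ)⟩

theorem euclidean {ι : Type*} [Fintype ι] {f : E → EuclideanSpace ℝ ι}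
    (hf : ∀ i, IsLipschitz fun x => f x i) : IsLipschitz f := by
  choose k hk using hf
  have h : LipschitzWith (Finset.univ.sup k) fun x i => f x i := by
    refine LipschitzWith.of_dist_le_mul fun x y => ?_
    refine (dist_pi_le_iff (by positivity)).2 fun i => ((hk i).dist_le_mul x y).trans ?_
    gcongr
    exact Finset.le_sup (Finset.mem_univ i)
  exact ⟨_, (PiLp.lipschitzWith_toLp 2 fun _ : ι => ℝ).comp h⟩

end IsLipschitz

namespace MultiAreaSystem

variable {n m : ℕ} (S : MultiAreaSystem n m) (i : Fin (n + 1))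

theorem isLipschitz_flow : IsLipschitz fun z : PState n => S.flow z.α i :=
  IsLipschitz.mulVec _ (fun k => IsLipschitz.coord (Coord.angle k)) i

theorem isLipschitz_lTilde : IsLipschitz fun z => S.lTilde z i :=
  ((((IsLipschitz.coord (Coord.freq i)).const_mul _).add (.const _)).add
    (S.isLipschitz_flow i)).add (((IsLipschitz.const _).sub (.coord (Coord.freq i))).const_mul _)

theorem isLipschitz_uTilde : IsLipschitz fun z => S.uTilde z i :=
  ((((IsLipschitz.coord (Coord.freq i)).const_mul _).add (.const _)).add
    (S.isLipschitz_flow i)).sub (((IsLipschitz.coord (Coord.freq i)).sub (.const _)).const_mul _)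

theorem isLipschitz_corrector : IsLipschitz fun z => S.corrector z i :=
  ((IsLipschitz.coord (Coord.ref i)).max ((IsLipschitz.const _).max (S.isLipschitz_lTilde i))).min
    ((IsLipschitz.const _).min (S.isLipschitz_uTilde i))

theorem isLipschitz_field : IsLipschitz S.field := by
  refine IsLipschitz.euclidean fun k => ?_
  cases k with
  | angle i => exact IsLipschitz.mulVec _ (fun k => IsLipschitz.coord (Coord.freq k)) i
  | freq i =>
    exact (((((IsLipschitz.coord (Coord.freq i)).const_mul _).neg.add
      (S.isLipschitz_corrector i)).sub (.const _)).sub (S.isLipschitz_flow i)).const_mul _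
  | ref i =>
    exact ((((IsLipschitz.coord (Coord.ref i)).const_mul _).neg.sub (.const _)).sub
      (.coord (Coord.mult i))).sub (.coord (Coord.freq i))
  | mult i => exact (IsLipschitz.coord (Coord.ref i)).sub (.const _)

end MultiAreaSystem

end Lipschitz

end

theorem mainTheorem4 {n m : ℕ} (S : MultiAreaSystem n m) (zlo zhi : Coord n → EReal)
    (hZ : box zlo zhi ⊆ S.capacitySet) (z₀ : PState n) (hz₀ : z₀ ∈ box zlo zhi)
    (hfeas : S.CorrectorFeasible zlo zhi z₀) :
    ∃ (T : ℝ) (z : ℝ → PState n), IsCaratheodorySolution zlo zhi S.field z₀ T z ∧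
      ∀ (T' : ℝ) (z' : ℝ → PState n), IsCaratheodorySolution zlo zhi S.field z₀ T' z' →
        ∀ t ∈ Set.Ico 0 (min T T'), z' t = z t := by
  obtain ⟨K, hK⟩ := S.isLipschitz_field
  obtain ⟨T, z, hz⟩ := exists_isCaratheodorySolution hK hz₀
  exact ⟨T, z, hz, fun T' z' hz' t ht => (hz.eqOn hK hz' ht).symm⟩
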